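/- **Setting.** Let $A\in\{0,1\}^{n\times n}$ be the (symmetric) adjacency matrix of an undirected graph on the node set $V=\{1,\dots,n\}$, let $\deg(i)=\sum_k A_{ik}$, and let $\hat A=D^{-1}A$ with $D=\mathrm{diag}(\deg(i))$ be its row-normalization (the row of an isolated node is $0$). Every node $i$ has a label $y_i$ in one of two classes, $V=\tilde V_1\cup\tilde V_2$, both nonempty. The labels of the nodes in a set $T\subseteq V$ are known; $p=|T|/n$. Label-SBP uses $\hat A$ as positive graph and the negative matrix $(A^-_l)_{ij}=1$ if $i,j\in T$ and $y_i\ne y_j$, $-1$ if $i,j\in T$ and $y_i=y_j$, $0$ if one of the two labels is unknown. With weights $a,b>0$ for the positive and negative graph, the induced signed graph $\hat{\mathcal G}^l_s$ has the signed adjacency matrix $W=a\hat A-bA^-_l$; distinct nodes $i,j$ are joined by a positive (negative) edge if $W_{ij}>0$ ($W_{ij}<0$). Assume that $a<b$, or that $a=b$ (for instance $a=b=1$) and every node with a neighbour in the other class has degree at least $2$. For a signed graph $W$, let $\mathcal P(v)$ be the set of nodes $u\neq v$ with $y_u=y_v$ and $W_{vu}\le 0$, let $\mathcal N(v)$ be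 the set of nodes $u$ with $y_u\neq y_v$ and $W_{vu}\ge 0$, and let $\mathcal{SID}=\frac1{2n}\sum_v(|\mathcal P(v)|+|\mathcal N(v)|)$. A signed graph is structurally balanced if $V$ is the disjoint union of two nonempty sets such that all edges inside each set are positive and all edges between the sets are negative. Constrained signed propagation: let $c>0$, let $\mathcal F_c$ be the truncation to $[-c,c]$ ($\mathcal F_c(z)=-c$ for $z<-c$, $z$ for $z\in[-c,c]$, $c$ for $z>c$), and let $\alpha,\beta>0$. At each step $k$ a random edge $\{i,j\}$ of the signed graph is selected, independently over the steps and with a fixed law $q$ that gives every edge positive probability (for instance uniformly); with $\theta=\alpha$ if the edge is positive and $\theta=-\beta$ if it is negative, $$X_i^{(k+1)}=\mathcal F_c\big((1-\theta)X_i^{(k)}+\theta X_j^{(k)}\big),\qquad X_j^{(k+1)}=\mathcal F_c\big((1-\theta)X_j^{(k)}+\theta X_i^{(k)}\big),$$ and all other nodes keep their values. **Theorem.** Under full supervision ($p=1$), $\mathcal{SID}(\hat{\mathcal G}^l_s)=0$, and $\hat{\mathcal G}^l_s$ is a structurally balanced complete signed graph with the two classes $\tilde V_1,\tilde V_2$ as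 parts. Consequently, for every $\alpha\in(0,1/2)$ there is $\beta_0>0$ (depending neither on $c$ nor on the initial values) such that for all $\beta>\beta_0$, all $c>0$ and Lebesgue-almost every initial value $X^{(0)}\in[-c,c]^n$ there is a random variable $l$ with values in $\{-c,c\}$ such that $$\mathbb P\Big(\lim_{k\to\infty}X_i^{(k)}=l\ \text{ for all } i\in\tilde V_1;\quad \lim_{k\to\infty}X_i^{(k)}=-l\ \text{ for all } i\in\tilde V_2\Big)=1,$$ that is, almost surely one of the two classes converges to $c$ and the other one to $-c$. -/

import Mathlib

open MeasureTheory ProbabilityTheory Filter Topology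

namespace LabelSBP

noncomputable section

variable {n : ℕ}

/-- `A` is the adjacency matrix of an undirected, unweighted graph: a symmetric `0/1` matrix
(self-loops are allowed, not required). -/
structure IsAdjacency (A : Matrix (Fin n) (Fin n) ℝ) : Prop where
  zero_or_one : ∀ i j, A i j = 0 ∨ A i j = 1
  symm : ∀ i j, A i j = A j i

/-- Degree of node `i`. -/
def degree (A : Matrix (Fin n) (Fin n) ℝ) (i : Fin n) : ℝ := ∑ k, A i k

/-- Row-normalized adjacency matrix `D⁻¹ A`; the row of an isolated node is zero. -/
def rowNormalize (A : Matrix (Fin n) (Fin n) ℝ) : Matrix (Fin n) (Fin n) ℝ :=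
  fun i j => A i j / degree A i

/-- Negative adjacency matrix of Label-SBP for ground-truth labels `y`, of which only those of the
nodes in `T` are known. -/
def labelNeg (T : Finset (Fin n)) (y : Fin n → Fin 2) : Matrix (Fin n) (Fin n) ℝ :=
  fun i j => if i ∈ T ∧ j ∈ T then (if y i = y j then -1 else 1) else 0

/-- The ratio `p` of labelled nodes. -/
def labelRatio (T : Finset (Fin n)) : ℝ := (T.card : ℝ) / n

/-- Signed adjacency matrix induced by Label-SBP: the row-normalized graph is the positive graph,
`labelNeg` the negative one; `a` and `b` are the weights of the two. -/
def labelSBPGraph (A : Matrix (Fin n) (Fin n) ℝ) (T : Finset (Fin n)) (y : Fin n → Fin 2)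
    (a b : ℝ) : Matrix (Fin n) (Fin n) ℝ :=
  a • rowNormalize A - b • labelNeg T y

/-- The edges of the signed graph with signed adjacency matrix `W` join distinct nodes with a
nonzero entry; the sign of the edge is the sign of the entry. -/
def IsEdge (W : Matrix (Fin n) (Fin n) ℝ) (i j : Fin n) : Prop := i ≠ j ∧ W i j ≠ 0

/-- Every two distinct nodes are joined by an edge. -/
def IsCompleteSigned (W : Matrix (Fin n) (Fin n) ℝ) : Prop := ∀ i j, i ≠ j → IsEdge W i j

/-- `V = V₁ ∪ V₂` is a partition into nonempty parts such that edges within a part are positive and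
edges between the parts are negative. -/
structure IsBalancedPartition (W : Matrix (Fin n) (Fin n) ℝ) (V₁ V₂ : Set (Fin n)) : Prop where
  nonempty_left : V₁.Nonempty
  nonempty_right : V₂.Nonempty
  disjoint : Disjoint V₁ V₂
  union : V₁ ∪ V₂ = Set.univ
  pos_within : ∀ i j, IsEdge W i j → (i ∈ V₁ ∧ j ∈ V₁ ∨ i ∈ V₂ ∧ j ∈ V₂) → 0 < W i j
  neg_between : ∀ i j, IsEdge W i j → (i ∈ V₁ ∧ j ∈ V₂ ∨ i ∈ V₂ ∧ j ∈ V₁) → W i j < 0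

/-- Structural balance. -/
def IsStructurallyBalanced (W : Matrix (Fin n) (Fin n) ℝ) : Prop :=
  ∃ V₁ V₂ : Set (Fin n), IsBalancedPartition W V₁ V₂

open Classical in
/-- The other nodes with the label of `v` whose entry is non-positive (zero included). -/
def sidP (W : Matrix (Fin n) (Fin n) ℝ) (y : Fin n → Fin 2) (v : Fin n) : Finset (Fin n) :=
  Finset.univ.filter fun u => u ≠ v ∧ y u = y v ∧ W v u ≤ 0

open Classical in
/-- The nodes with a label different from that of `v` whose entry is non-negative (zero
included). -/
def sidN (W : Matrix (Fin n) (Fin n) ℝ) (y : Fin n → Fin 2) (v : Fin n) : Finset (Fin n) :=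
  Finset.univ.filter fun u => y u ≠ y v ∧ 0 ≤ W v u

/-- Structural imbalance degree. -/
def SID (W : Matrix (Fin n) (Fin n) ℝ) (y : Fin n → Fin 2) : ℝ :=
  1 / (2 * (n : ℝ)) * ∑ v, (((sidP W y v).card : ℝ) + ((sidN W y v).card : ℝ))

/-- The bounded function `F_c`: truncation to `[-c, c]`. -/
def trunc (c z : ℝ) : ℝ := if z < -c then -c else if c < z then c else z

open Classical in
/-- The coefficient `θ` of an edge of weight `w`: `α` for a positive and `-β` for a negative edge
(`0` without an edge). -/
def theta (α β w : ℝ) : ℝ := if 0 < w then α else if w < 0 then -β else 0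

/-- One step of constrained signed propagation, in which the two nodes of the pair `e` interact:
`x_s ↦ F_c ((1 - θ) x_s + θ x_{-s})` for `s ∈ {e.1, e.2}`; all other nodes keep their value. -/
def pairStep (W : Matrix (Fin n) (Fin n) ℝ) (α β c : ℝ) (e : Fin n × Fin n) (x : Fin n → ℝ) :
    Fin n → ℝ := fun s =>
  if s = e.1 then
    trunc c ((1 - theta α β (W e.1 e.2)) * x e.1 + theta α β (W e.1 e.2) * x e.2)
  else if s = e.2 then
    trunc c ((1 - theta α β (W e.2 e.1)) * x e.2 + theta α β (W e.2 e.1) * x e.1)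
  else x s

/-- Node values after `k` steps along the sequence of pairs `e`, started at `x₀`. -/
def propagate (W : Matrix (Fin n) (Fin n) ℝ) (α β c : ℝ) (e : ℕ → Fin n × Fin n)
    (x₀ : Fin n → ℝ) : ℕ → Fin n → ℝ
  | 0 => x₀
  | k + 1 => pairStep W α β c (e k) (propagate W α β c e x₀ k)

/-- The law `q` selects edges of the signed graph only, and every edge `{i, j}` with positive
probability (in at least one of its two orderings). -/
structure SelectsEdges (W : Matrix (Fin n) (Fin n) ℝ) (q : PMF (Fin n × Fin n)) : Prop where
  edge_of_ne_zero : ∀ i j, q (i, j) ≠ 0 → IsEdge W i j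
  ne_zero_of_edge : ∀ i j, IsEdge W i j → q (i, j) ≠ 0 ∨ q (j, i) ≠ 0

/-- The random pair selection process: independent pairs with common law `q`. -/
structure IsPairSelection {Ω : Type*} [MeasurableSpace Ω] (P : Measure Ω)
    (q : PMF (Fin n × Fin n)) (E : ℕ → Ω → Fin n × Fin n) : Prop where
  measurable : ∀ k, Measurable (E k)
  indep : iIndepFun E P
  law : ∀ k, P.map (E k) = q.toMeasure

end

end LabelSBP

/-! With all labels known, `W` has entries at least `b` inside a class, and entries that are an
element of `D⁻¹A` times `a`, minus `b`, across the classes. The assumptions on `a`, `b` and the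
degrees make the latter negative, so all static claims follow from this sign pattern
(`IsClassSigned`).

For the dynamics, the two polarized states (one class at `c`, the other at `-c`) are fixed by every
step, so almost sure absorption in them is enough. The quantity to follow is the spread `D`, the
largest difference of two node values. A positive edge shrinks `D` at most by the factor `1 - 2α`,
and a negative edge never shrinks it. Moreover some pair of nodes from different classes always
differs by at least `D / 2`, and selecting it, which has probability at least `p`, multiplies `D` by
at least `β / 2` or brings it to its maximum `2c`. For small `s` and then large `β`, `D ^ (-s)`
therefore contracts on average as long as `D < 2c` (`avg_lyapunov_le`). From full spread, at most
`3n + 1` prescribed selections lead to a polarized state (`exists_path_polar`).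

Both facts combine in `tendsto_avg_iterate_zero`. The probability of never being absorbed, as a
function of the initial state, is harmonic. The drift shows that a bound for it at full spread holds
everywhere, and the path improves any bound at full spread by a fixed factor below 1, so it
vanishes. The argument needs only `D > 0` initially, which fails on a null set. -/

namespace LabelSBP

noncomputable section

/-! ### Absorption of a Markov chain with finitely many random maps, by drift and reachability. -/

section Averaging

variable {I X : Type*} [Fintype I]

/-- The transition operator of the chain that applies the map `step e` with probability `q e`. -/
def avg (q : I → ℝ) (step : I → X → X) (f : X → ℝ) (x : X) : ℝ := ∑ e, q e * f (step e x)

variable {q : I → ℝ} {step : I → X → X}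

lemma weighted_sum_le (hq0 : ∀ e, 0 ≤ q e) (hq1 : ∑ e, q e = 1) {f : I → ℝ} {a b p : ℝ}
    (ha : ∀ e, q e ≠ 0 → f e ≤ a) {e₀ : I} (hb : f e₀ ≤ b) (hba : b ≤ a) (hp : p ≤ q e₀) :
    ∑ e, q e * f e ≤ a - p * (a - b) := by
  classical
  have h : ∀ e, q e * f e ≤ q e * a - (if e = e₀ then q e * (a - b) else 0) := by
    intro e
    split_ifs with he
    · subst he
      nlinarith [mul_le_mul_of_nonneg_left hb (hq0 e)]
    · by_cases h0 : q e = 0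
      · simp [h0]
      · simpa using mul_le_mul_of_nonneg_left (ha e h0) (hq0 e)
  calc ∑ e, q e * f e ≤ ∑ e, (q e * a - (if e = e₀ then q e * (a - b) else 0)) :=
        Finset.sum_le_sum fun e _ => h e
    _ = a - q e₀ * (a - b) := by
        rw [Finset.sum_sub_distrib, ← Finset.sum_mul, hq1]; simp
    _ ≤ a - p * (a - b) := by nlinarith [mul_le_mul_of_nonneg_right hp (sub_nonneg.2 hba)]

lemma weighted_sum_le_of_le (hq0 : ∀ e, 0 ≤ q e) {f g : I → ℝ}
    (h : ∀ e, q e ≠ 0 → f e ≤ g e) : ∑ e, q e * f e ≤ ∑ e, q e * g e := by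
  refine Finset.sum_le_sum fun e _ => ?_
  by_cases h0 : q e = 0
  · simp [h0]
  · exact mul_le_mul_of_nonneg_left (h e h0) (hq0 e)

/-- If `V` contracts on average off `H`, a bound of a harmonic function on `H` holds everywhere. -/
lemma harmonic_le_of_drift (hq0 : ∀ e, 0 ≤ q e) (hq1 : ∑ e, q e = 1) {G H : Set X}
    (hG : ∀ e, q e ≠ 0 → ∀ x ∈ G, step e x ∈ G) {V u : X → ℝ} {m ρ M S : ℝ} (hm : 0 < m)
    (hρ0 : 0 ≤ ρ) (hρ1 : ρ < 1) (hMS : M ≤ S) (hV0 : ∀ x ∈ G, 0 ≤ V x)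
    (hVm : ∀ x ∈ G, x ∉ H → m ≤ V x) (hVd : ∀ x ∈ G, x ∉ H → avg q step V x ≤ ρ * V x)
    (hu : ∀ x ∈ G, u x = avg q step u x) (huS : ∀ x ∈ G, u x ≤ S)
    (huM : ∀ x ∈ G, x ∈ H → u x ≤ M) : ∀ x ∈ G, u x ≤ M := by
  -- Off `H`, `V ≥ m` turns the crude bound `S` into the case `k = 0`. Each use of harmonicity off
  -- `H` then gains a factor `ρ`, while on `H` the bound `M` is already better.
  have hk : ∀ k : ℕ, ∀ x ∈ G, u x ≤ M + (S - M) / m * ρ ^ k * V x := by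
    have hc : 0 ≤ (S - M) / m := div_nonneg (sub_nonneg.2 hMS) hm.le
    intro k
    induction k with
    | zero =>
      intro x hx
      by_cases hH : x ∈ H
      · have := mul_nonneg hc (hV0 x hx)
        have := huM x hx hH
        simp; linarith
      · have h1 := mul_le_mul_of_nonneg_left (hVm x hx hH) hc
        rw [div_mul_cancel₀ _ hm.ne'] at h1
        have := huS x hx
        simp; linarith
    | succ k ih =>
      intro x hx
      have hck : 0 ≤ (S - M) / m * ρ ^ k := mul_nonneg hc (pow_nonneg hρ0 k)
      by_cases hH : x ∈ H
      · have h1 := mul_nonneg (mul_nonneg hc (pow_nonneg hρ0 (k + 1))) (hV0 x hx)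
        have := huM x hx hH
        linarith
      · rw [hu x hx]
        calc avg q step u x
            ≤ ∑ e, q e * (M + (S - M) / m * ρ ^ k * V (step e x)) :=
              weighted_sum_le_of_le hq0 fun e he => ih _ (hG e he x hx)
          _ = M + (S - M) / m * ρ ^ k * avg q step V x := by
              simp only [mul_add, Finset.sum_add_distrib, ← Finset.sum_mul, hq1, one_mul, avg,
                Finset.mul_sum]
              congr 1
              exact Finset.sum_congr rfl fun e _ => by ring
          _ ≤ M + (S - M) / m * ρ ^ k * (ρ * V x) := by
              have := mul_le_mul_of_nonneg_left (hVd x hx hH) hck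
              linarith
          _ = _ := by ring
  intro x hx
  have ht : Tendsto (fun k : ℕ => M + (S - M) / m * ρ ^ k * V x) atTop (𝓝 M) := by
    have := (((tendsto_pow_atTop_nhds_zero_of_lt_one hρ0 hρ1).const_mul ((S - M) / m)).mul_const
      (V x)).const_add M
    simpa using this
  exact ge_of_tendsto' ht fun k => hk k x hx

/-- If a path of likely steps leads to a zero of a harmonic function, the bound improves. -/
lemma harmonic_le_of_path (hq0 : ∀ e, 0 ≤ q e) (hq1 : ∑ e, q e = 1) {G : Set X}
    (hG : ∀ e, q e ≠ 0 → ∀ x ∈ G, step e x ∈ G) {u : X → ℝ} {p S : ℝ} (hp : 0 < p)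
    (hS : 0 ≤ S) (hu : ∀ x ∈ G, u x = avg q step u x) (huS : ∀ x ∈ G, u x ≤ S) (L : List I) :
    ∀ x ∈ G, (∀ e ∈ L, p ≤ q e) → u (L.foldl (fun x e => step e x) x) ≤ 0 →
      u x ≤ (1 - p ^ L.length) * S := by
  induction L with
  | nil => intro x _ _ h; simpa using h
  | cons e L ih =>
    intro x hx hL h
    have hpe : p ≤ q e := hL e (by simp)
    have h1 := ih (step e x) (hG e (hp.trans_le hpe).ne' x hx)
      (fun e' he' => hL e' (by simp [he'])) (by simpa using h)
    rw [hu x hx]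
    have h2 := weighted_sum_le hq0 hq1 (f := fun e => u (step e x)) (a := S)
      (fun e he => huS _ (hG e he x hx)) h1
      (by nlinarith [mul_nonneg (pow_pos hp L.length).le hS]) hpe
    refine h2.trans (le_of_eq ?_)
    rw [List.length_cons, pow_succ]; ring

lemma avg_mono (hq0 : ∀ e, 0 ≤ q e) {f g : X → ℝ} (h : f ≤ g) : avg q step f ≤ avg q step g :=
  fun _ => weighted_sum_le_of_le hq0 fun _ _ => h _

/-- A chain with a drift towards `H`, from which the absorbing set `B` can be reached within boundedly
many likely steps, is absorbed. -/
theorem tendsto_avg_iterate_zero (hq0 : ∀ e, 0 ≤ q e) (hq1 : ∑ e, q e = 1) {G H B : Set X}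
    (hG : ∀ e, q e ≠ 0 → ∀ x ∈ G, step e x ∈ G) (hB : ∀ e, q e ≠ 0 → ∀ x ∈ B, step e x ∈ B)
    {V : X → ℝ} {m ρ p : ℝ} {N : ℕ} (hm : 0 < m) (hρ0 : 0 ≤ ρ) (hρ1 : ρ < 1) (hp : 0 < p)
    (hp1 : p ≤ 1) (hV0 : ∀ x ∈ G, 0 ≤ V x) (hVm : ∀ x ∈ G, x ∉ H → m ≤ V x)
    (hVd : ∀ x ∈ G, x ∉ H → avg q step V x ≤ ρ * V x)
    (hpath : ∀ x ∈ G, x ∈ H → ∃ L : List I, L.length ≤ N ∧ (∀ e ∈ L, p ≤ q e) ∧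
      L.foldl (fun x e => step e x) x ∈ B) {x : X} (hx : x ∈ G) :
    Tendsto (fun k => (avg q step)^[k] (Bᶜ.indicator 1) x) atTop (𝓝 0) := by
  classical
  set w : ℕ → X → ℝ := fun k => (avg q step)^[k] (Bᶜ.indicator 1) with hw
  have hws : ∀ k, w (k + 1) = avg q step (w k) := fun k => Function.iterate_succ_apply' _ _ _
  have hw0 : ∀ k, 0 ≤ w k := by
    intro k
    induction k with
    | zero =>
      intro x
      simp only [hw, Function.iterate_zero, id]
      exact Set.indicator_nonneg (by simp) x
    | succ k ih =>
      rw [hws]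
      exact fun x => Finset.sum_nonneg fun e _ => mul_nonneg (hq0 e) (ih _)
  have hle1 : ∀ x, w 0 x ≤ 1 := fun x => by
    simp only [hw, Function.iterate_zero, id]
    exact Set.indicator_le_self' (by simp) x
  -- `w k x` is the probability of being outside `B` after `k` steps; it decreases because `B`
  -- cannot be left.
  have hstep : ∀ k, w (k + 1) ≤ w k := by
    intro k
    induction k with
    | zero =>
      intro x
      rw [hws]
      by_cases hxB : x ∈ B
      · have h : ∑ e, q e * w 0 (step e x) ≤ ∑ e, q e * 0 :=
          weighted_sum_le_of_le hq0 fun e he => by simp [hw, hB e he x hxB]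
        simp only [avg]
        refine h.trans ?_
        simpa using hw0 0 x
      · have h : ∑ e, q e * w 0 (step e x) ≤ ∑ e, q e * 1 :=
          weighted_sum_le_of_le hq0 fun e _ => hle1 _
        simp only [avg]
        refine h.trans ?_
        simp [hq1, hw, hxB]
    | succ k ih =>
      rw [hws (k + 1)]
      exact (avg_mono hq0 ih).trans_eq (hws k).symm
  have hanti : Antitone w := antitone_nat_of_succ_le hstep
  set u : X → ℝ := fun x => ⨅ k, w k x with hu
  have hlim : ∀ x, Tendsto (fun k => w k x) atTop (𝓝 (u x)) := fun x =>
    tendsto_atTop_ciInf (fun a b h => hanti h x) ⟨0, by rintro _ ⟨k, rfl⟩; exact hw0 k x⟩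
  have hu0 : ∀ x, 0 ≤ u x := fun x => ge_of_tendsto' (hlim x) fun k => hw0 k x
  have huw : ∀ x, u x ≤ w 0 x := fun x => le_of_tendsto' (hlim x) fun k => hanti (Nat.zero_le k) x
  have huB : ∀ x ∈ B, u x ≤ 0 := fun x hxB => (huw x).trans (by simp [hw, hxB])
  have hharm : ∀ x, u x = avg q step u x := by
    intro x
    refine tendsto_nhds_unique ((tendsto_add_atTop_iff_nat 1).2 (hlim x)) ?_
    simp only [hws]
    exact tendsto_finsetSum _ fun e _ => (hlim _).const_mul _
  have hpN1 : p ^ N ≤ 1 := pow_le_one₀ hp.le hp1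
  have hpN : 0 < p ^ N := pow_pos hp N
  -- A bound `S` on `G` becomes `(1 - p ^ N) * S` on `H` by the path into `B`, and the drift carries
  -- this back to all of `G`.
  have hk : ∀ k : ℕ, ∀ x ∈ G, u x ≤ (1 - p ^ N) ^ k := by
    intro k
    induction k with
    | zero => intro x _; simpa using (huw x).trans (hle1 x)
    | succ k ih =>
      have hS : 0 ≤ (1 - p ^ N) ^ k := pow_nonneg (by linarith) k
      rw [pow_succ']
      refine harmonic_le_of_drift hq0 hq1 hG hm hρ0 hρ1 (by nlinarith) hV0 hVm hVd
        (fun x _ => hharm x) ih fun x hx hxH => ?_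
      obtain ⟨L, hLN, hLp, hLB⟩ := hpath x hx hxH
      refine (harmonic_le_of_path hq0 hq1 hG hp hS (fun x _ => hharm x) ih L x hx hLp
        (huB _ hLB)).trans ?_
      have := pow_le_pow_of_le_one hp.le hp1 hLN
      exact mul_le_mul_of_nonneg_right (by linarith) hS
  have hux : u x = 0 := le_antisymm
    (ge_of_tendsto' (tendsto_pow_atTop_nhds_zero_of_lt_one (by linarith) (by linarith))
      fun k => hk k x hx) (hu0 x)
  simpa [hux] using hlim x

end Averaging

/-! ### Sign pattern and structural balance of the fully supervised graph. -/

section SignedGraph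

variable {n : ℕ}

/-- Nodes of the same class are joined by a positive, nodes of different classes by a negative
edge. -/
structure IsClassSigned (W : Matrix (Fin n) (Fin n) ℝ) (y : Fin n → Fin 2) : Prop where
  pos : ∀ i j, y i = y j → 0 < W i j
  neg : ∀ i j, y i ≠ y j → W i j < 0

lemma eq_univ_of_labelRatio (hn : n ≠ 0) {T : Finset (Fin n)} (hp : labelRatio T = 1) :
    T = Finset.univ := by
  have hn' : (n : ℝ) ≠ 0 := by exact_mod_cast hn
  rw [labelRatio, div_eq_one_iff_eq hn'] at hp
  exact (Finset.card_eq_iff_eq_univ T).1 (by rw [Fintype.card_fin]; exact_mod_cast hp)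

lemma IsAdjacency.nonneg {A : Matrix (Fin n) (Fin n) ℝ} (hA : IsAdjacency A) (i j : Fin n) :
    0 ≤ A i j := by
  rcases hA.zero_or_one i j with h | h <;> simp [h]

lemma IsAdjacency.degree_nonneg {A : Matrix (Fin n) (Fin n) ℝ} (hA : IsAdjacency A) (i : Fin n) :
    0 ≤ degree A i := Finset.sum_nonneg fun k _ => hA.nonneg i k

/-- Across classes an entry of `D⁻¹A` is at most 1, so `a < b` suffices. For `a = b`, a neighbour of
a node of degree 1 would give the entry 0; degree at least 2 lowers the entry of `D⁻¹A` to at most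
`1 / 2`. -/
lemma isClassSigned_labelSBPGraph {A : Matrix (Fin n) (Fin n) ℝ} (hA : IsAdjacency A)
    (y : Fin n → Fin 2) {a b : ℝ} (ha : 0 < a)
    (hab : a < b ∨ (a = b ∧ ∀ i j, y i ≠ y j → A i j = 1 → 2 ≤ degree A i)) :
    IsClassSigned (labelSBPGraph A Finset.univ y a b) y := by
  have hb : 0 < b := by
    rcases hab with h | ⟨h, _⟩ <;> linarith
  refine ⟨fun i j hij => ?_, fun i j hij => ?_⟩
  · have h : 0 ≤ A i j / degree A i := div_nonneg (hA.nonneg i j) (hA.degree_nonneg i)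
    simp only [labelSBPGraph, rowNormalize, labelNeg, Matrix.sub_apply, Matrix.smul_apply,
      smul_eq_mul, Finset.mem_univ, and_self, if_true, if_pos hij]
    nlinarith [mul_nonneg ha.le h]
  · simp only [labelSBPGraph, rowNormalize, labelNeg, Matrix.sub_apply, Matrix.smul_apply,
      smul_eq_mul, Finset.mem_univ, and_self, if_true, if_neg hij]
    rcases hA.zero_or_one i j with h0 | h1
    · simp [h0, hb]
    · rcases hab with h | ⟨h, hdeg⟩
      · have hd : 1 ≤ degree A i :=
          h1 ▸ Finset.single_le_sum (fun k _ => hA.nonneg i k) (Finset.mem_univ j)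
        have : A i j / degree A i ≤ 1 := (div_le_one (by linarith)).2 (h1 ▸ hd)
        nlinarith
      · have hd := hdeg i j hij h1
        have : A i j / degree A i ≤ 1 / 2 := by
          rw [h1]; exact one_div_le_one_div_of_le (by norm_num) hd
        nlinarith

variable {W : Matrix (Fin n) (Fin n) ℝ} {y : Fin n → Fin 2}

lemma IsClassSigned.ne_zero (h : IsClassSigned W y) (i j : Fin n) : W i j ≠ 0 := by
  by_cases hij : y i = y j
  · exact (h.pos i j hij).ne'
  · exact (h.neg i j hij).ne

lemma IsClassSigned.isCompleteSigned (h : IsClassSigned W y) : IsCompleteSigned W :=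
  fun i j hij => ⟨hij, h.ne_zero i j⟩

lemma IsClassSigned.sid_eq_zero (h : IsClassSigned W y) : SID W y = 0 := by
  have hP : ∀ v, sidP W y v = ∅ := fun v => Finset.filter_eq_empty_iff.2
    fun u _ ⟨_, hu, hW⟩ => (h.pos v u hu.symm).not_ge hW
  have hN : ∀ v, sidN W y v = ∅ := fun v => Finset.filter_eq_empty_iff.2
    fun u _ ⟨hu, hW⟩ => (h.neg v u (Ne.symm hu)).not_ge hW
  simp [SID, hP, hN]

lemma IsClassSigned.isBalancedPartition (h : IsClassSigned W y) (hy : Function.Surjective y) :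
    IsBalancedPartition W {i | y i = 0} {i | y i = 1} where
  nonempty_left := hy 0
  nonempty_right := hy 1
  disjoint := Set.disjoint_left.2 fun i (h0 : y i = 0) (h1 : y i = 1) => by simp [h0] at h1
  union := Set.eq_univ_of_forall fun i => by
    have : y i = 0 ∨ y i = 1 := by omega
    exact this
  pos_within := by
    rintro i j - (⟨hi, hj⟩ | ⟨hi, hj⟩) <;> exact h.pos i j (hi.trans hj.symm)
  neg_between := by
    rintro i j - (⟨hi, hj⟩ | ⟨hi, hj⟩) <;> refine h.neg i j ?_ <;>
      simp_all

end SignedGraph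

/-! ### Effect of single interactions on the spread, and paths to polarization. -/

section Dynamics

variable {n : ℕ} {W : Matrix (Fin n) (Fin n) ℝ} {y : Fin n → Fin 2} {α β c : ℝ}

/-- The cube `[-c, c]ⁿ`. -/
def cube (n : ℕ) (c : ℝ) : Set (Fin n → ℝ) := {x | ∀ i, x i ∈ Set.Icc (-c) c}

lemma trunc_mem (hc : 0 < c) (z : ℝ) : trunc c z ∈ Set.Icc (-c) c := by
  unfold trunc
  split_ifs <;> constructor <;> linarith

lemma trunc_of_mem {z : ℝ} (h : z ∈ Set.Icc (-c) c) : trunc c z = z := by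
  rw [trunc, if_neg (not_lt.2 h.1), if_neg (not_lt.2 h.2)]

lemma trunc_of_ge (hc : 0 < c) {z : ℝ} (h : c ≤ z) : trunc c z = c := by
  unfold trunc
  split_ifs <;> linarith

lemma trunc_of_le (hc : 0 < c) {z : ℝ} (h : z ≤ -c) : trunc c z = -c := by
  unfold trunc
  split_ifs <;> linarith

lemma le_trunc {w z : ℝ} (hw : w ≤ c) (h : w ≤ z) : w ≤ trunc c z := by
  unfold trunc
  split_ifs <;> linarith

lemma trunc_le {w z : ℝ} (hw : -c ≤ w) (h : z ≤ w) : trunc c z ≤ w := by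
  unfold trunc
  split_ifs <;> linarith

/-- Each endpoint reads the entry in its own row of `W`, so the order of the pair is irrelevant
although `W` need not be symmetric. -/
lemma pairStep_swap {i j : Fin n} (h : i ≠ j) (x : Fin n → ℝ) :
    pairStep W α β c (j, i) x = pairStep W α β c (i, j) x := by
  funext s
  simp only [pairStep]
  by_cases hi : s = i
  · subst hi; simp [h]
  · simp [hi]

lemma pairStep_mem_cube (hc : 0 < c) {x : Fin n → ℝ} (hx : x ∈ cube n c) (e : Fin n × Fin n) :
    pairStep W α β c e x ∈ cube n c := by
  intro s
  simp only [pairStep]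
  split_ifs
  · exact trunc_mem hc _
  · exact trunc_mem hc _
  · exact hx s

lemma pairStep_of_ne {i j k : Fin n} (hi : k ≠ i) (hj : k ≠ j) (x : Fin n → ℝ) :
    pairStep W α β c (i, j) x k = x k := by simp [pairStep, hi, hj]

namespace IsClassSigned

lemma pairStep_pos_left (h : IsClassSigned W y)
    {i j : Fin n} (hij : y i = y j) (x : Fin n → ℝ) :
    pairStep W α β c (i, j) x i = trunc c ((1 - α) * x i + α * x j) := by
  simp [pairStep, theta, h.pos i j hij]

lemma pairStep_pos_right (h : IsClassSigned W y)
    {i j : Fin n} (hne : i ≠ j) (hij : y i = y j) (x : Fin n → ℝ) :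
    pairStep W α β c (i, j) x j = trunc c ((1 - α) * x j + α * x i) := by
  rw [← pairStep_swap hne, h.pairStep_pos_left hij.symm]

lemma pairStep_neg_left (h : IsClassSigned W y)
    {i j : Fin n} (hij : y i ≠ y j) (x : Fin n → ℝ) :
    pairStep W α β c (i, j) x i = trunc c (x i + β * (x i - x j)) := by
  have := h.neg i j hij
  simp only [pairStep, theta, if_true, if_neg this.not_gt, if_pos this]
  congr 1; ring

lemma pairStep_neg_right (h : IsClassSigned W y)
    {i j : Fin n} (hij : y i ≠ y j) (x : Fin n → ℝ) :
    pairStep W α β c (i, j) x j = trunc c (x j + β * (x j - x i)) := by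
  rw [← pairStep_swap (ne_of_apply_ne y hij), h.pairStep_neg_left hij.symm]

end IsClassSigned

/-- The state in which one class has the value `v` and the other one `-v`. -/
def polar (y : Fin n → Fin 2) (v : ℝ) : Fin n → ℝ := fun i => if y i = 0 then v else -v

lemma polar_of_eq {i j : Fin n} (h : y i = y j) (v : ℝ) : polar y v i = polar y v j := by
  simp [polar, h]

lemma polar_of_ne {i j : Fin n} (h : y i ≠ y j) (v : ℝ) : polar y v i = -polar y v j := by
  simp only [polar]
  split_ifs with h1 h2 h2
  · exact absurd (h1.trans h2.symm) h
  · simp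
  · rfl
  · omega

lemma polar_mem_cube (hc : 0 < c) {v : ℝ} (hv : v = c ∨ v = -c) : polar y v ∈ cube n c := by
  intro i
  simp only [polar]
  rcases hv with rfl | rfl <;> split_ifs <;> constructor <;> linarith

/-- Averaging equal values changes nothing, and repulsion pushes `±c` outwards, where truncation
cancels it. -/
lemma IsClassSigned.pairStep_polar (h : IsClassSigned W y) (hc : 0 < c) (hβ : 0 < β) {v : ℝ}
    (hv : v = c ∨ v = -c) (e : Fin n × Fin n) :
    pairStep W α β c e (polar y v) = polar y v := by
  obtain ⟨i, j⟩ := e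
  have hneg : ∀ z : ℝ, z = c ∨ z = -c → trunc c (z + β * (z - -z)) = z := by
    rintro z (rfl | rfl)
    · exact trunc_of_ge hc (by nlinarith [mul_pos hβ hc])
    · exact trunc_of_le hc (by nlinarith [mul_pos hβ hc])
  have hpol : ∀ k, polar y v k = c ∨ polar y v k = -c := by
    intro k
    simp only [polar]
    rcases hv with rfl | rfl <;> split_ifs <;> simp
  have hmem := polar_mem_cube (y := y) hc hv
  have key : ∀ i j : Fin n, pairStep W α β c (i, j) (polar y v) i = polar y v i := by
    intro i j
    by_cases hij : y i = y j
    · rw [h.pairStep_pos_left hij, ← polar_of_eq hij]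
      have : (1 - α) * polar y v i + α * polar y v i = polar y v i := by ring
      rw [this, trunc_of_mem (hmem i)]
    · rw [h.pairStep_neg_left hij, polar_of_ne (Ne.symm hij)]
      exact hneg _ (hpol i)
  funext s
  by_cases hi : s = i
  · subst hi; exact key s j
  by_cases hj : s = j
  · subst hj; rw [← pairStep_swap (Ne.symm hi)]; exact key s i
  exact pairStep_of_ne hi hj _

/-- The largest difference of two node values. -/
def spread (x : Fin n → ℝ) : ℝ := ⨆ e : Fin n × Fin n, (x e.1 - x e.2)

lemma sub_le_spread (x : Fin n → ℝ) (i j : Fin n) : x i - x j ≤ spread x :=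
  le_ciSup (f := fun e : Fin n × Fin n => x e.1 - x e.2) (Set.finite_range _).bddAbove (i, j)

lemma exists_spread_eq [Nonempty (Fin n)] (x : Fin n → ℝ) :
    ∃ i j, x i - x j = spread x ∧ ∀ k, x j ≤ x k ∧ x k ≤ x i := by
  obtain ⟨⟨i, j⟩, hij⟩ := exists_eq_ciSup_of_finite (f := fun e : Fin n × Fin n => x e.1 - x e.2)
  replace hij : x i - x j = spread x := hij
  refine ⟨i, j, hij, fun k => ⟨?_, ?_⟩⟩
  · linarith [sub_le_spread x i k]
  · linarith [sub_le_spread x k j]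

lemma spread_pos {x : Fin n → ℝ} {i j : Fin n} (h : x i ≠ x j) : 0 < spread x := by
  rcases h.lt_or_gt with h | h
  · linarith [sub_le_spread x j i]
  · linarith [sub_le_spread x i j]

/-- If the extreme nodes share a class, any node of the other class is at distance at least half the
spread from one of them. -/
lemma exists_cross_pair (hy : Function.Surjective y) (x : Fin n → ℝ) :
    ∃ i j, y i ≠ y j ∧ spread x / 2 ≤ x i - x j := by
  have : Nonempty (Fin n) := ⟨(hy 0).choose⟩
  obtain ⟨i, j, hij, hk⟩ := exists_spread_eq x
  have h0 : 0 ≤ spread x := by linarith [(hk i).1]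
  by_cases hyij : y i = y j
  · obtain ⟨k, hyk⟩ : ∃ k, y k ≠ y i := by
      obtain ⟨k, hk⟩ := hy (1 - y i)
      exact ⟨k, by omega⟩
    rcases le_total (spread x / 2) (x i - x k) with h | h
    · exact ⟨i, k, hyk.symm, h⟩
    · exact ⟨k, j, hyij ▸ hyk, by linarith⟩
  · exact ⟨i, j, hyij, by linarith⟩

namespace IsClassSigned

lemma spread_pairStep_ge (h : IsClassSigned W y)
    (hα0 : 0 < α) (hα : α < 1 / 2) (hβ : 0 < β) {i j : Fin n}
    (hij : i ≠ j) {x : Fin n → ℝ} (hx : x ∈ cube n c) :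
    (1 - 2 * α) * spread x ≤ spread (pairStep W α β c (i, j) x) := by
  have : Nonempty (Fin n) := ⟨i⟩
  obtain ⟨s, t, hst, hk⟩ := exists_spread_eq x
  have h0 : 0 ≤ spread x := by linarith [(hk s).1]
  by_cases hyij : y i = y j
  · set x' := pairStep W α β c (i, j) x with hx'
    have hst0 : x t ≤ x s := (hk t).2
    -- Convex combinations stay in the cube, so truncation is idle. The maximal node loses at most
    -- `α * spread x` and the minimal one gains at most as much.
    have key : ∀ k, (∃ l, x' k = (1 - α) * x k + α * x l) := by
      have hconv : ∀ k l, (1 - α) * x k + α * x l ∈ Set.Icc (-c) c := fun k l =>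
        ⟨by nlinarith [(hx k).1, (hx l).1], by nlinarith [(hx k).2, (hx l).2]⟩
      intro k
      by_cases hki : k = i
      · subst hki
        exact ⟨j, by rw [hx', h.pairStep_pos_left hyij, trunc_of_mem (hconv k j)]⟩
      by_cases hkj : k = j
      · subst hkj
        exact ⟨i, by rw [hx', h.pairStep_pos_right hij hyij, trunc_of_mem (hconv k i)]⟩
      · exact ⟨k, by rw [hx', pairStep_of_ne hki hkj]; ring⟩
    obtain ⟨l, hl⟩ := key s
    obtain ⟨m, hm⟩ := key t
    have h1 := sub_le_spread x' s t
    have h2 := (hk l).1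
    have h3 := (hk m).2
    nlinarith
  -- A negative edge moves the larger value up and the smaller one down, so neither extreme is lost.
  · wlog hle : x j ≤ x i generalizing i j
    · rw [← pairStep_swap hij]
      exact this hij.symm (Ne.symm hyij) (not_le.1 hle).le
    set x' := pairStep W α β c (i, j) x with hx'
    have hi : x i ≤ x' i := by
      rw [hx', h.pairStep_neg_left hyij]
      exact le_trunc (hx i).2 (by nlinarith)
    have hj : x' j ≤ x j := by
      rw [hx', h.pairStep_neg_right hyij]
      exact trunc_le (hx j).1 (by nlinarith)
    have hs : ∃ k, x s ≤ x' k := by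
      by_cases hsj : s = j
      · exact ⟨i, by rw [hsj]; exact hle.trans hi⟩
      by_cases hsi : s = i
      · exact ⟨i, by rw [hsi]; exact hi⟩
      · exact ⟨s, by rw [hx', pairStep_of_ne hsi hsj]⟩
    have ht : ∃ k, x' k ≤ x t := by
      by_cases hti : t = i
      · exact ⟨j, by rw [hti]; exact hj.trans hle⟩
      by_cases htj : t = j
      · exact ⟨j, by rw [htj]; exact hj⟩
      · exact ⟨t, by rw [hx', pairStep_of_ne hti htj]⟩
    obtain ⟨k, hk1⟩ := hs
    obtain ⟨l, hl1⟩ := ht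
    have := sub_le_spread x' k l
    nlinarith

/-- Repulsion moves both endpoints apart by at least `β / 2` times the spread. If truncation stops
both, they sit at `c` and `-c`; otherwise one endpoint makes its full move and the difference of the
pair is at least that large. -/
lemma spread_pairStep_cross (h : IsClassSigned W y)
    (hc : 0 < c) (hβ : 0 < β) {i j : Fin n}
    (hij : y i ≠ y j) {x : Fin n → ℝ} (hx : x ∈ cube n c) (h0 : 0 < spread x)
    (hd : spread x / 2 ≤ x i - x j) :
    2 * c ≤ spread (pairStep W α β c (i, j) x) ∨
      β / 2 * spread x ≤ spread (pairStep W α β c (i, j) x) := by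
  have h1 := sub_le_spread (pairStep W α β c (i, j) x) i j
  rw [h.pairStep_neg_left hij, h.pairStep_neg_right hij] at h1
  have hβd : β * (spread x / 2) ≤ β * (x i - x j) := mul_le_mul_of_nonneg_left hd hβ.le
  have hβd' : β * (x j - x i) = -(β * (x i - x j)) := by ring
  have hi := hx i
  have hj := hx j
  have hβ0 := mul_pos hβ h0
  rw [hβd'] at h1
  rcases le_total c (x i + β * (x i - x j)) with hA | hA
  · rw [trunc_of_ge hc hA] at h1
    rcases le_total (x j + -(β * (x i - x j))) (-c) with hB | hB
    · rw [trunc_of_le hc hB] at h1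
      left; linarith
    · rw [trunc_of_mem ⟨hB, by linarith [hj.2]⟩] at h1
      right; linarith [hj.2]
  · rw [trunc_of_mem ⟨by linarith [hi.1], hA⟩] at h1
    have := trunc_le (c := c) (w := x j) hj.1 (z := x j + -(β * (x i - x j))) (by linarith)
    right; linarith

/-- Three interactions bring the node `k` to the value `v` of the node `i` of its class. -/
lemma exists_path_settle (h : IsClassSigned W y)
    (hc : 0 < c) (hα0 : 0 < α) (hα : α < 1 / 2) (hβ2 : 2 ≤ β)
    (hβα : 1 ≤ β * α) {i j k : Fin n} (hij : y i ≠ y j) (hki : k ≠ i) (hyk : y k = y i) {v : ℝ}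
    (hv : v = c ∨ v = -c) {x : Fin n → ℝ} (hx : x ∈ cube n c) (hxi : x i = v) (hxj : x j = -v) :
    ∃ x', x' = pairStep W α β c (i, j) (pairStep W α β c (k, j) (pairStep W α β c (k, i) x)) ∧
      x' i = v ∧ x' j = -v ∧ x' k = v ∧ ∀ m, m ≠ i → m ≠ j → m ≠ k → x' m = x m := by
  refine ⟨_, rfl, ?_⟩
  have hijne : i ≠ j := ne_of_apply_ne y hij
  have hykj : y k ≠ y j := hyk ▸ hij
  have hkj : k ≠ j := ne_of_apply_ne y hykj
  set x₁ := pairStep W α β c (k, i) x with hx₁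
  set x₂ := pairStep W α β c (k, j) x₁ with hx₂
  have hconv : ∀ k l, (1 - α) * x k + α * x l ∈ Set.Icc (-c) c := fun k l =>
    ⟨by nlinarith [(hx k).1, (hx l).1], by nlinarith [(hx k).2, (hx l).2]⟩
  have h1k : x₁ k = (1 - α) * x k + α * v := by
    rw [hx₁, h.pairStep_pos_left hyk, trunc_of_mem (hconv _ _), hxi]
  have h1i : x₁ i = (1 - α) * v + α * x k := by
    rw [hx₁, h.pairStep_pos_right hki hyk, trunc_of_mem (hconv _ _), hxi]
  have h1j : x₁ j = -v := by rw [hx₁, pairStep_of_ne hkj.symm hijne.symm, hxj]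
  have hk := hx k
  have hβc : c ≤ β * α * c := by nlinarith
  -- After averaging with `i`, the node `k` is at least `2 * α * c` away from `-v`; repulsion from
  -- `j` multiplies this by `β`, and `β * α ≥ 1` covers the whole width `2 * c`.
  have h2k : x₂ k = v := by
    rw [hx₂, h.pairStep_neg_left hykj, h1k, h1j]
    rcases hv with rfl | rfl
    · have h1 : 2 * α * v ≤ (1 - α) * x k + α * v - -v := by nlinarith [hk.1]
      have h2 := mul_le_mul_of_nonneg_left h1 (by linarith : (0 : ℝ) ≤ β)
      refine trunc_of_ge hc ?_
      nlinarith [(hconv k k).1, hk.1]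
    · have h1 : 2 * α * c ≤ -((1 - α) * x k + α * -c - - -c) := by nlinarith [hk.2]
      have h2 := mul_le_mul_of_nonneg_left h1 (by linarith : (0 : ℝ) ≤ β)
      refine trunc_of_le hc ?_
      nlinarith [hk.2]
  have h2j : x₂ j = -v := by
    rw [hx₂, h.pairStep_neg_right hykj, h1k, h1j]
    rcases hv with rfl | rfl
    · have h1 : 0 ≤ (1 - α) * x k + α * v + v := by nlinarith [hk.1]
      refine trunc_of_le hc ?_
      nlinarith [mul_nonneg (by linarith : (0 : ℝ) ≤ β) h1]
    · have h1 : 0 ≤ -((1 - α) * x k + α * -c + -c) := by nlinarith [hk.2]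
      rw [neg_neg]
      refine trunc_of_ge hc ?_
      nlinarith [mul_nonneg (by linarith : (0 : ℝ) ≤ β) h1]
  have h2i : x₂ i = (1 - α) * v + α * x k := by
    rw [hx₂, pairStep_of_ne hki.symm hijne, h1i]
  refine ⟨?_, ?_, ?_, ?_⟩
  -- Averaging pulled `i` away from `v`, but `α < 1 / 2` keeps it on the side of `v`, so repulsion
  -- from `j` restores it.
  · rw [h.pairStep_neg_left hij, h2i, h2j]
    rcases hv with rfl | rfl
    · have h1 : 0 ≤ (1 - α) * v + α * x k := by nlinarith [hk.1]
      refine trunc_of_ge hc ?_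
      nlinarith [mul_nonneg (by linarith : (0 : ℝ) ≤ β) h1]
    · have h1 : 0 ≤ -((1 - α) * -c + α * x k) := by nlinarith [hk.2]
      refine trunc_of_le hc ?_
      nlinarith [mul_nonneg (by linarith : (0 : ℝ) ≤ β) h1]
  · rw [h.pairStep_neg_right hij, h2i, h2j]
    rcases hv with rfl | rfl
    · have h1 : 0 ≤ (1 - α) * v + α * x k := by nlinarith [hk.1]
      refine trunc_of_le hc ?_
      nlinarith [mul_nonneg (by linarith : (0 : ℝ) ≤ β) h1]
    · have h1 : 0 ≤ -((1 - α) * -c + α * x k) := by nlinarith [hk.2]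
      rw [neg_neg]
      refine trunc_of_ge hc ?_
      nlinarith [mul_nonneg (by linarith : (0 : ℝ) ≤ β) h1]
  · rw [pairStep_of_ne hki hkj, h2k]
  · intro m hmi hmj hmk
    rw [pairStep_of_ne hmi hmj, hx₂, pairStep_of_ne hmk hmj, hx₁, pairStep_of_ne hmk hmi]

/-- A path that brings the nodes of `s` to `v` or `-v`, according to their class. -/
lemma exists_path_settle_finset (h : IsClassSigned W y)
    {Q : Fin n × Fin n → Prop} (hc : 0 < c) (hα0 : 0 < α)
    (hα : α < 1 / 2) (hβ2 : 2 ≤ β) (hβα : 1 ≤ β * α)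
    (hQ : ∀ i j, i ≠ j → ∃ e, Q e ∧ ∀ x, pairStep W α β c e x = pairStep W α β c (i, j) x)
    {i j : Fin n} (hij : y i ≠ y j) {v : ℝ} (hv : v = c ∨ v = -c) {x : Fin n → ℝ}
    (hx : x ∈ cube n c) (hxi : x i = v) (hxj : x j = -v) (s : Finset (Fin n)) :
    ∃ L : List (Fin n × Fin n), L.length ≤ 3 * s.card ∧ (∀ e ∈ L, Q e) ∧
      ∃ x', x' = L.foldl (fun x e => pairStep W α β c e x) x ∧ x' ∈ cube n c ∧ x' i = v ∧
        x' j = -v ∧ ∀ k ∈ s, x' k = if y k = y i then v else -v := by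
  induction s using Finset.induction_on with
  | empty => exact ⟨[], by simp, by simp, x, rfl, hx, hxi, hxj, by simp⟩
  | insert k s hks ih =>
    obtain ⟨L, hL, hLQ, x', hx', hmem, hi, hj, hset⟩ := ih
    have hijne : i ≠ j := ne_of_apply_ne y hij
    have hcard : 3 * (insert k s).card = 3 * s.card + 3 := by
      rw [Finset.card_insert_of_notMem hks]; ring
    by_cases hki : k = i
    · refine ⟨L, by omega, hLQ, x', hx', hmem, hi, hj, fun m hm => ?_⟩
      rcases Finset.mem_insert.1 hm with rfl | hm
      · simp [hki, hi]
      · exact hset m hm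
    by_cases hkj : k = j
    · refine ⟨L, by omega, hLQ, x', hx', hmem, hi, hj, fun m hm => ?_⟩
      rcases Finset.mem_insert.1 hm with rfl | hm
      · rw [hkj, hj, if_neg hij.symm]
      · exact hset m hm
    have extend : ∀ i' j' : Fin n, i' ≠ j' → k ≠ i' → k ≠ j' → ∃ L' : List (Fin n × Fin n),
        L'.length ≤ 3 * s.card + 3 ∧ (∀ e ∈ L', Q e) ∧
        L'.foldl (fun x e => pairStep W α β c e x) x = pairStep W α β c (i', j')
          (pairStep W α β c (k, j') (pairStep W α β c (k, i') x')) := by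
      intro i' j' h1 h2 h3
      obtain ⟨e₁, hQ₁, he₁⟩ := hQ k i' h2
      obtain ⟨e₂, hQ₂, he₂⟩ := hQ k j' h3
      obtain ⟨e₃, hQ₃, he₃⟩ := hQ i' j' h1
      refine ⟨L ++ [e₁, e₂, e₃], by simp; omega, ?_, ?_⟩
      · intro e he
        simp only [List.mem_append, List.mem_cons, List.not_mem_nil, or_false] at he
        rcases he with he | rfl | rfl | rfl
        · exact hLQ e he
        all_goals assumption
      · rw [List.foldl_append, ← hx']
        simp [he₁, he₂, he₃]
    by_cases hyk : y k = y i
    · obtain ⟨L', hL', hLQ', hfold⟩ := extend i j hijne hki hkj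
      obtain ⟨x'', hx'', h1, h2, h3, h4⟩ :=
        h.exists_path_settle hc hα0 hα hβ2 hβα hij hki hyk hv hmem hi hj
      refine ⟨L', by omega, hLQ', x'', hx''.trans hfold.symm, ?_, h1, h2, fun m hm => ?_⟩
      · rw [hx'']
        exact pairStep_mem_cube hc (pairStep_mem_cube hc (pairStep_mem_cube hc hmem _) _) _
      · by_cases hmk : m = k
        · rw [hmk, h3, if_pos hyk]
        by_cases hmi : m = i
        · rw [hmi, h1, if_pos rfl]
        by_cases hmj : m = j
        · rw [hmj, h2, if_neg hij.symm]
        rw [h4 m hmi hmj hmk]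
        exact hset m (Finset.mem_of_mem_insert_of_ne hm hmk)
    -- With only two classes, `k` belongs to that of `j`: the roles of `i`, `v` and `j`, `-v` are
    -- exchanged.
    · have hyk' : y k = y j := by omega
      obtain ⟨L', hL', hLQ', hfold⟩ := extend j i hijne.symm hkj hki
      obtain ⟨x'', hx'', h1, h2, h3, h4⟩ :=
        h.exists_path_settle hc hα0 hα hβ2 hβα hij.symm hkj hyk' (v := -v)
          (by rcases hv with rfl | rfl <;> simp) hmem hj (by rw [hi, neg_neg])
      rw [neg_neg] at h2
      refine ⟨L', by omega, hLQ', x'', hx''.trans hfold.symm, ?_, h2, h1, fun m hm => ?_⟩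
      · rw [hx'']
        exact pairStep_mem_cube hc (pairStep_mem_cube hc (pairStep_mem_cube hc hmem _) _) _
      · by_cases hmk : m = k
        · rw [hmk, h3, if_neg hyk]
        by_cases hmi : m = i
        · rw [hmi, h2, if_pos rfl]
        by_cases hmj : m = j
        · rw [hmj, h1, if_neg hij.symm]
        rw [h4 m hmj hmi hmk]
        exact hset m (Finset.mem_of_mem_insert_of_ne hm hmk)

/-- From a state of full spread, a path of bounded length leads to a polarized state. -/
lemma exists_path_polar (h : IsClassSigned W y)
    {Q : Fin n × Fin n → Prop} (hy : Function.Surjective y) (hc : 0 < c)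
    (hα0 : 0 < α) (hα : α < 1 / 2) (hβ2 : 2 ≤ β) (hβα : 1 ≤ β * α)
    (hQ : ∀ i j, i ≠ j → ∃ e, Q e ∧ ∀ x, pairStep W α β c e x = pairStep W α β c (i, j) x)
    {x : Fin n → ℝ} (hx : x ∈ cube n c) (hs : 2 * c ≤ spread x) :
    ∃ L : List (Fin n × Fin n), L.length ≤ 3 * n + 1 ∧ (∀ e ∈ L, Q e) ∧
      L.foldl (fun x e => pairStep W α β c e x) x ∈ ({polar y c, polar y (-c)} : Set _) := by
  obtain ⟨i, j, hij, hd⟩ := exists_cross_pair hy x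
  have hijne : i ≠ j := ne_of_apply_ne y hij
  -- With `β ≥ 2`, a gap of `c` moves each endpoint by at least `2 * c`, enough to cross the whole
  -- interval. This opening step accounts for the `+ 1` in the length.
  have hd' : c ≤ x i - x j := by linarith
  have hm := mul_le_mul hβ2 hd' hc.le (by linarith)
  have hi : pairStep W α β c (i, j) x i = c := by
    rw [h.pairStep_neg_left hij]
    exact trunc_of_ge hc (by linarith [(hx i).1])
  have hj : pairStep W α β c (i, j) x j = -c := by
    rw [h.pairStep_neg_right hij]
    exact trunc_of_le hc (by linarith [(hx j).2])
  obtain ⟨e, hQe, he⟩ := hQ i j hijne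
  obtain ⟨L, hL, hLQ, x', hx', -, -, -, hset⟩ := h.exists_path_settle_finset hc hα0 hα hβ2 hβα hQ
    hij (Or.inl rfl) (pairStep_mem_cube hc hx (i, j)) hi hj Finset.univ
  refine ⟨e :: L, by simpa using hL, ?_, ?_⟩
  · intro e' he'
    rcases List.mem_cons.1 he' with rfl | he'
    · exact hQe
    · exact hLQ _ he'
  · rw [List.foldl_cons, he, ← hx']
    by_cases hyi : y i = 0
    · left
      funext k
      rw [hset k (Finset.mem_univ k), polar, hyi]
    · right
      funext k
      rw [hset k (Finset.mem_univ k)]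
      simp only [polar, neg_neg]
      by_cases hk : y k = 0
      · rw [if_pos hk, if_neg (by omega)]
      · rw [if_neg hk, if_pos (by omega)]

end IsClassSigned

end Dynamics

/-! ### Average contraction of a negative power of the spread. -/

section Drift

variable {n : ℕ} {W : Matrix (Fin n) (Fin n) ℝ} {y : Fin n → Fin 2} {α β c s p : ℝ}

/-- The Lyapunov function: a negative power of the spread, set to zero at full spread. -/
def lyapunov (c s : ℝ) (x : Fin n → ℝ) : ℝ :=
  if 2 * c ≤ spread x then 0 else spread x ^ (-s)

lemma lyapunov_le (hs : 0 < s) {x : Fin n → ℝ} {r : ℝ} (hr : 0 < r) (h : r ≤ spread x) :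
    lyapunov c s x ≤ r ^ (-s) := by
  unfold lyapunov
  split_ifs
  · positivity
  · exact Real.rpow_le_rpow_of_nonpos hr h (by linarith)

/-- Every step costs at most a factor `1 + p / 2`, and a step of probability at least `p` brings the
factor `1 / 4`; on average `1 + p / 2 - p * (1 + p / 2 - 1 / 4) ≤ 1 - p / 4`. -/
lemma IsClassSigned.avg_lyapunov_le (h : IsClassSigned W y) (hy : Function.Surjective y)
    {q : Fin n × Fin n → ℝ} (hq0 : ∀ e, 0 ≤ q e) (hq1 : ∑ e, q e = 1)
    (hqe : ∀ e, q e ≠ 0 → e.1 ≠ e.2) (hc : 0 < c) (hα0 : 0 < α) (hα : α < 1 / 2) (hβ : 0 < β)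
    (hp : 0 < p)
    (hQ : ∀ i j, i ≠ j → ∃ e, p ≤ q e ∧ ∀ x, pairStep W α β c e x = pairStep W α β c (i, j) x)
    (hs : 0 < s) (hαs : (1 - 2 * α) ^ (-s) ≤ 1 + p / 2) (hβs : (β / 2) ^ (-s) ≤ 1 / 4)
    {x : Fin n → ℝ} (hx : x ∈ cube n c) (hx0 : 0 < spread x) (hxc : ¬ 2 * c ≤ spread x) :
    avg q (pairStep W α β c) (lyapunov c s) x ≤ (1 - p / 4) * lyapunov c s x := by
  obtain ⟨i, j, hij, hd⟩ := exists_cross_pair hy x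
  obtain ⟨e₀, hpe, he₀⟩ := hQ i j (ne_of_apply_ne y hij)
  have hD : 0 < spread x ^ (-s) := by positivity
  have hV : lyapunov c s x = spread x ^ (-s) := if_neg hxc
  have hα' : 0 < 1 - 2 * α := by linarith
  have h1 : ∀ e, q e ≠ 0 →
      lyapunov c s (pairStep W α β c e x) ≤ (1 + p / 2) * spread x ^ (-s) := by
    intro e he
    refine (lyapunov_le hs (mul_pos hα' hx0)
      (h.spread_pairStep_ge hα0 hα hβ (hqe e he) hx)).trans ?_
    rw [Real.mul_rpow hα'.le hx0.le]
    exact mul_le_mul_of_nonneg_right hαs hD.le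
  have h2 : lyapunov c s (pairStep W α β c e₀ x) ≤ 1 / 4 * spread x ^ (-s) := by
    rw [he₀]
    rcases h.spread_pairStep_cross (α := α) hc hβ hij hx hx0 hd with h3 | h3
    · rw [lyapunov, if_pos h3]; positivity
    · refine (lyapunov_le hs (by positivity) h3).trans ?_
      rw [Real.mul_rpow (by positivity) hx0.le]
      exact mul_le_mul_of_nonneg_right hβs hD.le
  refine (weighted_sum_le hq0 hq1 (f := fun e => lyapunov c s (pairStep W α β c e x)) h1 h2
    (mul_le_mul_of_nonneg_right (by linarith) hD.le) hpe).trans ?_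
  rw [hV]
  nlinarith [mul_nonneg (sq_nonneg p) hD.le]

/-- A chain of node values that do not all agree is absorbed by the polarized states. -/
lemma IsClassSigned.tendsto_avg_polar (h : IsClassSigned W y) (hy : Function.Surjective y)
    {q : Fin n × Fin n → ℝ} (hq0 : ∀ e, 0 ≤ q e) (hq1 : ∑ e, q e = 1)
    (hqe : ∀ e, q e ≠ 0 → e.1 ≠ e.2) (hc : 0 < c) (hα0 : 0 < α) (hα : α < 1 / 2) (hβ2 : 2 ≤ β)
    (hβα : 1 ≤ β * α) (hp : 0 < p) (hp1 : p ≤ 1)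
    (hQ : ∀ i j, i ≠ j → ∃ e, p ≤ q e ∧ ∀ x, pairStep W α β c e x = pairStep W α β c (i, j) x)
    (hs : 0 < s) (hαs : (1 - 2 * α) ^ (-s) ≤ 1 + p / 2) (hβs : (β / 2) ^ (-s) ≤ 1 / 4)
    {x : Fin n → ℝ} (hx : x ∈ cube n c) (hx0 : 0 < spread x) :
    Tendsto (fun k => (avg q (pairStep W α β c))^[k]
      (({polar y c, polar y (-c)} : Set (Fin n → ℝ))ᶜ.indicator 1) x) atTop (𝓝 0) := by
  have hβ : 0 < β := by linarith
  refine tendsto_avg_iterate_zero (G := {x | x ∈ cube n c ∧ 0 < spread x})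
    (H := {x | 2 * c ≤ spread x}) (V := lyapunov c s) (m := (2 * c) ^ (-s)) (ρ := 1 - p / 4)
    (N := 3 * n + 1) hq0 hq1 ?_ ?_ (by positivity) (by linarith) (by linarith) hp hp1 ?_ ?_ ?_ ?_
    ⟨hx, hx0⟩
  · rintro e he x ⟨hx, hx0⟩
    refine ⟨pairStep_mem_cube hc hx e, lt_of_lt_of_le ?_
      (h.spread_pairStep_ge hα0 hα hβ (hqe e he) hx)⟩
    exact mul_pos (by linarith) hx0
  · rintro e he x (rfl | rfl)
    · rw [h.pairStep_polar hc hβ (Or.inl rfl)]; simp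
    · rw [h.pairStep_polar hc hβ (Or.inr rfl)]; simp
  · rintro x ⟨hx, hx0⟩
    unfold lyapunov
    split_ifs <;> positivity
  · rintro x ⟨hx, hx0⟩ hxc
    rw [lyapunov, if_neg (show ¬ 2 * c ≤ spread x from hxc)]
    exact Real.rpow_le_rpow_of_nonpos hx0 (not_le.1 hxc).le (by linarith)
  · rintro x ⟨hx, hx0⟩ hxc
    exact h.avg_lyapunov_le hy hq0 hq1 hqe hc hα0 hα hβ hp hQ hs hαs hβs hx hx0 hxc
  · rintro x ⟨hx, -⟩ hxc
    exact h.exists_path_polar (Q := fun e => p ≤ q e) hy hc hα0 hα hβ2 hβα hQ hx hxc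

end Drift

/-! ### From the transition operator to the random selection process. -/

section Selection

variable {n : ℕ} {W : Matrix (Fin n) (Fin n) ℝ} {α β c : ℝ}

lemma propagate_congr {e e' : ℕ → Fin n × Fin n} (x₀ : Fin n → ℝ) {k : ℕ}
    (h : ∀ t < k, e t = e' t) : propagate W α β c e x₀ k = propagate W α β c e' x₀ k := by
  induction k with
  | zero => rfl
  | succ k ih =>
    simp only [propagate]
    rw [ih fun t ht => h t (ht.trans k.lt_succ_self), h k k.lt_succ_self]

lemma sum_toReal_pmf {I : Type*} [Fintype I] (q : PMF I) : ∑ e, (q e).toReal = 1 := by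
  rw [← ENNReal.toReal_sum fun e _ => q.apply_ne_top e, ← tsum_fintype (L := .unconditional _),
    q.tsum_coe]
  simp

variable {Ω : Type*} [MeasurableSpace Ω] {P : Measure Ω} {q : PMF (Fin n × Fin n)}
  {E : ℕ → Ω → Fin n × Fin n}

/-- The node values at time `k` are a function of the first `k` selected pairs. -/
lemma exists_propagate_eq [Nonempty (Fin n)] (W : Matrix (Fin n) (Fin n) ℝ) (α β c : ℝ)
    (x₀ : Fin n → ℝ) (k : ℕ) : ∃ g : (Finset.range k → Fin n × Fin n) → Fin n → ℝ,
      ∀ e : ℕ → Fin n × Fin n, propagate W α β c e x₀ k = g fun i => e i := by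
  classical
  refine ⟨fun f => propagate W α β c
    (fun t => if h : t ∈ Finset.range k then f ⟨t, h⟩ else Classical.arbitrary _) x₀ k, fun e =>
    propagate_congr x₀ fun t ht => ?_⟩
  simp [ht]

lemma measurable_propagate [Nonempty (Fin n)] (hE : ∀ k, Measurable (E k)) (x₀ : Fin n → ℝ)
    (k : ℕ) : Measurable fun ω => propagate W α β c (fun t => E t ω) x₀ k := by
  obtain ⟨g, hg⟩ := exists_propagate_eq W α β c x₀ k
  simp only [hg]
  exact (measurable_of_finite g).comp (measurable_pi_lambda _ fun i => hE i)

/-- This is the Markov property: the state at time `k` depends on the first `k` pairs only, hence is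
independent of `E k`. Splitting by the value of `E k` factorizes the integral. -/
lemma integral_propagate_succ [Nonempty (Fin n)] [IsProbabilityMeasure P]
    (hE : IsPairSelection P q E) (x₀ : Fin n → ℝ) (f : (Fin n → ℝ) → ℝ) (k : ℕ) :
    ∫ ω, f (propagate W α β c (fun t => E t ω) x₀ (k + 1)) ∂P =
      ∫ ω, avg (fun e => (q e).toReal) (pairStep W α β c) f
        (propagate W α β c (fun t => E t ω) x₀ k) ∂P := by
  classical
  obtain ⟨g, hg⟩ := exists_propagate_eq W α β c x₀ k
  set F : Ω → (Finset.range k → Fin n × Fin n) := fun ω i => E i ω with hF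
  have hFm : Measurable F := measurable_pi_lambda _ fun i => hE.measurable i
  have hint : ∀ φ : (Finset.range k → Fin n × Fin n) → ℝ, Integrable (fun ω => φ (F ω)) P :=
    fun φ => (Integrable.of_finite (μ := P.map F) (f := φ)).comp_measurable hFm
  have hint' : ∀ φ : (Fin n × Fin n) → ℝ, Integrable (fun ω => φ (E k ω)) P :=
    fun φ => (Integrable.of_finite (μ := P.map (E k)) (f := φ)).comp_measurable (hE.measurable k)
  have hind : IndepFun (E k) F P := by
    have h := hE.indep.indepFun_finset {k} (Finset.range k) (by simp) hE.measurable
    have hφ : Measurable fun f : ({k} : Finset ℕ) → Fin n × Fin n => f ⟨k, by simp⟩ :=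
      measurable_pi_apply _
    exact h.comp hφ measurable_id
  have hone : ∀ e, ∫ ω, (if E k ω = e then (1 : ℝ) else 0) ∂P = (q e).toReal := by
    intro e
    have h1 : P (E k ⁻¹' {e}) = q e := by
      rw [← Measure.map_apply (hE.measurable k) (measurableSet_singleton e), hE.law k,
        PMF.toMeasure_apply_singleton _ _ (measurableSet_singleton e)]
    have h2 : (fun ω => if E k ω = e then (1 : ℝ) else 0) = (E k ⁻¹' {e}).indicator 1 := by
      funext ω
      simp [Set.indicator]
    rw [h2, integral_indicator_one (hE.measurable k (measurableSet_singleton e)), measureReal_def,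
      h1]
  have hprod : ∀ e, IndepFun (fun ω => if E k ω = e then (1 : ℝ) else 0)
      (fun ω => f (pairStep W α β c e (g (F ω)))) P := fun e =>
    hind.comp (φ := fun e' => if e' = e then (1 : ℝ) else 0)
      (ψ := fun z => f (pairStep W α β c e (g z))) (measurable_of_finite _) (measurable_of_finite _)
  calc ∫ ω, f (propagate W α β c (fun t => E t ω) x₀ (k + 1)) ∂P
      = ∫ ω, ∑ e, (if E k ω = e then (1 : ℝ) else 0) * f (pairStep W α β c e (g (F ω))) ∂P := by
        refine integral_congr_ae (Eventually.of_forall fun ω => ?_)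
        simp [propagate, hg, hF]
    _ = ∑ e, ∫ ω, (if E k ω = e then (1 : ℝ) else 0) * f (pairStep W α β c e (g (F ω))) ∂P := by
        refine integral_finsetSum _ fun e _ => ?_
        exact (hprod e).integrable_mul (hint' fun e' => if e' = e then (1 : ℝ) else 0)
          (hint fun z => f (pairStep W α β c e (g z)))
    _ = ∑ e, (q e).toReal * ∫ ω, f (pairStep W α β c e (g (F ω))) ∂P := by
        refine Finset.sum_congr rfl fun e _ => ?_
        rw [(hprod e).integral_fun_mul_eq_mul_integral
          (hint' fun e' => if e' = e then (1 : ℝ) else 0).aestronglyMeasurable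
          (hint fun z => f (pairStep W α β c e (g z))).aestronglyMeasurable, hone]
    _ = ∫ ω, avg (fun e => (q e).toReal) (pairStep W α β c) f (g (F ω)) ∂P := by
        simp only [avg]
        rw [integral_finsetSum _ fun e _ =>
          (hint fun z => f (pairStep W α β c e (g z))).const_mul _]
        simp only [integral_const_mul]
    _ = _ := by simp only [hg, hF]

lemma integral_propagate [Nonempty (Fin n)] [IsProbabilityMeasure P] (hE : IsPairSelection P q E)
    (x₀ : Fin n → ℝ) (k : ℕ) : ∀ f : (Fin n → ℝ) → ℝ,
    ∫ ω, f (propagate W α β c (fun t => E t ω) x₀ k) ∂P =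
      (avg (fun e => (q e).toReal) (pairStep W α β c))^[k] f x₀ := by
  induction k with
  | zero => intro f; simp [propagate]
  | succ k ih => intro f; rw [integral_propagate_succ hE, ih, Function.iterate_succ_apply]

/-- The almost sure absorption of the node values in `B`. -/
lemma measure_exists_mem_eq_one [Nonempty (Fin n)] [IsProbabilityMeasure P]
    (hE : IsPairSelection P q E) {x₀ : Fin n → ℝ} {B : Set (Fin n → ℝ)} (hB : MeasurableSet B)
    (h : Tendsto (fun k => (avg (fun e => (q e).toReal) (pairStep W α β c))^[k]
      (Bᶜ.indicator 1) x₀) atTop (𝓝 0)) :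
    P {ω | ∃ k, propagate W α β c (fun t => E t ω) x₀ k ∈ B} = 1 := by
  have hm : ∀ k, MeasurableSet {ω | propagate W α β c (fun t => E t ω) x₀ k ∈ B} := fun k =>
    measurable_propagate hE.measurable x₀ k hB
  have hreal : ∀ k, P.real {ω | propagate W α β c (fun t => E t ω) x₀ k ∈ B}ᶜ =
      (avg (fun e => (q e).toReal) (pairStep W α β c))^[k] (Bᶜ.indicator 1) x₀ := by
    intro k
    rw [← integral_propagate hE x₀ k, ← integral_indicator_one (hm k).compl]
    exact integral_congr_ae (Eventually.of_forall fun ω => rfl)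
  have hset : MeasurableSet {ω | ∃ k, propagate W α β c (fun t => E t ω) x₀ k ∈ B} := by
    rw [Set.ofPred_exists]
    exact MeasurableSet.iUnion hm
  rw [← prob_compl_eq_zero_iff hset, ← measureReal_eq_zero_iff]
  -- Never being in `B` implies not being in `B` at time `k`, for each `k`.
  refine le_antisymm (ge_of_tendsto' h fun k => ?_) measureReal_nonneg
  rw [← hreal k]
  exact measureReal_mono fun ω hω hk => hω ⟨k, hk⟩

/-- Almost every state has two different node values. -/
lemma ae_spread_pos {i j : Fin n} (hij : i ≠ j) :
    ∀ᵐ x ∂(volume : Measure (Fin n → ℝ)), 0 < spread x := by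
  set K : Submodule ℝ (Fin n → ℝ) :=
    LinearMap.ker (LinearMap.proj (R := ℝ) (φ := fun _ : Fin n => ℝ) i - LinearMap.proj j) with hK
  have hne : K ≠ ⊤ := by
    intro htop
    have hmem : (Pi.single i 1 : Fin n → ℝ) ∈ K := htop ▸ Submodule.mem_top
    simp [hK, hij.symm] at hmem
  have h0 : volume (K : Set (Fin n → ℝ)) = 0 := Measure.addHaar_submodule volume K hne
  refine measure_mono_null (fun x hx => ?_) h0
  by_contra hxK
  refine hx (spread_pos (i := i) (j := j) fun heq => hxK ?_)
  simp [hK, heq]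

lemma exists_pos_le_of_selectsEdges {W : Matrix (Fin n) (Fin n) ℝ} (hq : SelectsEdges W q)
    (hW : IsCompleteSigned W) :
    ∃ p : ℝ, 0 < p ∧ p ≤ 1 ∧ ∀ i j, i ≠ j → p ≤ (q (i, j)).toReal ∨ p ≤ (q (j, i)).toReal := by
  classical
  obtain ⟨e₀, he₀⟩ := q.support_nonempty
  have : Nonempty (Fin n × Fin n) := ⟨e₀⟩
  -- The value 1 at pairs of probability zero keeps them from lowering the minimum over the support.
  obtain ⟨m, hm⟩ := Finite.exists_min fun e => if q e = 0 then (1 : ℝ) else (q e).toReal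
  have hpos : ∀ e, 0 < if q e = 0 then (1 : ℝ) else (q e).toReal := by
    intro e
    split_ifs with h
    · exact one_pos
    · exact ENNReal.toReal_pos h (q.apply_ne_top e)
  have hle : ∀ e, q e ≠ 0 → (if q m = 0 then (1 : ℝ) else (q m).toReal) ≤ (q e).toReal :=
    fun e he => by simpa only [if_neg he] using hm e
  refine ⟨_, hpos m, ?_, fun i j hij => (hq.ne_zero_of_edge i j (hW i j hij)).imp (hle _) (hle _)⟩
  refine (hle e₀ ((PMF.mem_support_iff _ _).1 he₀)).trans ?_
  exact ENNReal.toReal_mono ENNReal.one_ne_top (q.coe_le_one e₀)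

end Selection

/-! ### The random limit and the choice of the exponent. -/

section Convergence

variable {n : ℕ} {W : Matrix (Fin n) (Fin n) ℝ} {y : Fin n → Fin 2} {α β c : ℝ}

lemma IsClassSigned.propagate_eq_polar (h : IsClassSigned W y) (hc : 0 < c) (hβ : 0 < β) {v : ℝ}
    (hv : v = c ∨ v = -c) {e : ℕ → Fin n × Fin n} {x₀ : Fin n → ℝ}
    {k : ℕ} (hk : propagate W α β c e x₀ k = polar y v) {m : ℕ} (hm : k ≤ m) :
    propagate W α β c e x₀ m = polar y v := by
  induction m, hm using Nat.le_induction with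
  | base => exact hk
  | succ m _ ih => rw [propagate, ih, h.pairStep_polar hc hβ hv]

/-- Absorption in the polarized states yields the random limit. -/
lemma IsClassSigned.exists_limit {Ω : Type*} [MeasurableSpace Ω] {P : Measure Ω}
    [IsProbabilityMeasure P] {E : ℕ → Ω → Fin n × Fin n} (h : IsClassSigned W y)
    (hy : Function.Surjective y) (hc : 0 < c) (hβ : 0 < β) (hE : ∀ k, Measurable (E k))
    {x₀ : Fin n → ℝ} (habs : P {ω | ∃ k, propagate W α β c (fun t => E t ω) x₀ k ∈
      ({polar y c, polar y (-c)} : Set (Fin n → ℝ))} = 1) :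
    ∃ l : Ω → ℝ, Measurable l ∧ (∀ ω, l ω = c ∨ l ω = -c) ∧
      P {ω |
        (∀ i, y i = 0 → Tendsto (fun k => propagate W α β c (fun t => E t ω) x₀ k i)
          atTop (𝓝 (l ω))) ∧
        (∀ i, y i = 1 → Tendsto (fun k => propagate W α β c (fun t => E t ω) x₀ k i)
          atTop (𝓝 (-l ω)))} = 1 := by
  classical
  have : Nonempty (Fin n) := ⟨(hy 0).choose⟩
  have hset : MeasurableSet {ω | ∃ k, propagate W α β c (fun t => E t ω) x₀ k = polar y c} := by
    rw [Set.ofPred_exists]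
    exact MeasurableSet.iUnion fun k =>
      measurable_propagate hE x₀ k (measurableSet_singleton (polar y c))
  -- The value `-c` also serves as default on the null event without absorption. Both poles cannot
  -- be reached, since each is absorbing and `c ≠ -c`.
  refine ⟨fun ω => if ∃ k, propagate W α β c (fun t => E t ω) x₀ k = polar y c then c else -c,
    Measurable.ite hset measurable_const measurable_const, fun ω => ?_, ?_⟩
  · by_cases hω : ∃ k, propagate W α β c (fun t => E t ω) x₀ k = polar y c <;> simp [hω]
  refine le_antisymm prob_le_one (habs ▸ measure_mono ?_)
  rintro ω ⟨k, hk⟩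
  have hlim : ∃ v, (v = c ∨ v = -c) ∧
      v = (if ∃ k, propagate W α β c (fun t => E t ω) x₀ k = polar y c then c else -c) ∧
      propagate W α β c (fun t => E t ω) x₀ k = polar y v := by
    by_cases hω : ∃ k, propagate W α β c (fun t => E t ω) x₀ k = polar y c
    · refine ⟨c, Or.inl rfl, by rw [if_pos hω], ?_⟩
      rcases hk with hk | hk
      · exact hk
      · obtain ⟨k', hk'⟩ := hω
        obtain ⟨i, hi⟩ := hy 0
        have h1 := h.propagate_eq_polar hc hβ (Or.inl rfl) hk' (le_max_left k' k)
        have h2 := h.propagate_eq_polar hc hβ (Or.inr rfl) hk (le_max_right k' k)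
        have h3 := congrFun (h1.symm.trans h2) i
        simp only [polar, hi, if_true] at h3
        linarith
    · exact ⟨-c, Or.inr rfl, by rw [if_neg hω], hk.resolve_left fun hk => hω ⟨k, hk⟩⟩
  obtain ⟨v, hv, hvl, hkv⟩ := hlim
  have htend : ∀ i, Tendsto (fun k => propagate W α β c (fun t => E t ω) x₀ k i) atTop
      (𝓝 (polar y v i)) := fun i => tendsto_const_nhds.congr' <|
    (eventually_ge_atTop k).mono fun m hm =>
      (congrFun (h.propagate_eq_polar hc hβ hv hkv hm) i).symm
  simp only [Set.mem_ofPred_eq, ← hvl]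
  refine ⟨fun i hi => ?_, fun i hi => ?_⟩
  · simpa [polar, hi] using htend i
  · simpa [polar, hi] using htend i

/-- The exponent of the Lyapunov function. -/
lemma exists_exponent {r p : ℝ} (hr : 0 < r) (hp : 0 < p) :
    ∃ s : ℝ, 0 < s ∧ r ^ (-s) ≤ 1 + p := by
  have ht : Tendsto (fun s : ℝ => r ^ (-s)) (𝓝 0) (𝓝 1) := by
    have : Continuous fun s : ℝ => r ^ (-s) :=
      Continuous.rpow continuous_const continuous_neg fun _ => Or.inl hr.ne'
    simpa using this.tendsto 0
  have h1 : ∀ᶠ s in 𝓝[>] (0 : ℝ), r ^ (-s) ≤ 1 + p :=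
    (ht.mono_left nhdsWithin_le_nhds).eventually_le_const (by linarith)
  obtain ⟨s, hs, hs0⟩ := (h1.and self_mem_nhdsWithin).exists
  exact ⟨s, hs0, hs⟩

end Convergence

end

end LabelSBP

/-! ### Choice of the constants and conclusion. -/

theorem mainTheorem5 {n : ℕ} (A : Matrix (Fin n) (Fin n) ℝ) (hA : LabelSBP.IsAdjacency A)
    (y : Fin n → Fin 2) (hy : Function.Surjective y)
    (T : Finset (Fin n)) (hp : LabelSBP.labelRatio T = 1)
    (a b : ℝ) (ha : 0 < a)
    (hab : a < b ∨
      (a = b ∧ ∀ i j, y i ≠ y j → A i j = 1 → 2 ≤ LabelSBP.degree A i))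
    (W : Matrix (Fin n) (Fin n) ℝ) (hW : W = LabelSBP.labelSBPGraph A T y a b) :
    LabelSBP.SID W y = 0 ∧
    LabelSBP.IsStructurallyBalanced W ∧
    LabelSBP.IsCompleteSigned W ∧
    LabelSBP.IsBalancedPartition W {i | y i = 0} {i | y i = 1} ∧
    ∀ q : PMF (Fin n × Fin n), LabelSBP.SelectsEdges W q →
      ∀ α : ℝ, 0 < α → α < 1 / 2 →
        ∃ β₀ : ℝ, 0 < β₀ ∧ ∀ β : ℝ, β₀ < β → ∀ c : ℝ, 0 < c →
          ∀ (Ω : Type*) [MeasurableSpace Ω] (P : Measure Ω) [IsProbabilityMeasure P]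
            (E : ℕ → Ω → Fin n × Fin n), LabelSBP.IsPairSelection P q E →
            ∀ᵐ x₀ ∂(volume.restrict {x : Fin n → ℝ | ∀ i, x i ∈ Set.Icc (-c) c}),
              ∃ l : Ω → ℝ, Measurable l ∧ (∀ ω, l ω = c ∨ l ω = -c) ∧
                P {ω |
                  (∀ i, y i = 0 → Tendsto
                    (fun k => LabelSBP.propagate W α β c (fun t => E t ω) x₀ k i)
                    atTop (𝓝 (l ω))) ∧
                  (∀ i, y i = 1 → Tendsto
                    (fun k => LabelSBP.propagate W α β c (fun t => E t ω) x₀ k i)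
                    atTop (𝓝 (-l ω)))} = 1 := by
  obtain rfl : T = Finset.univ :=
    LabelSBP.eq_univ_of_labelRatio (fun h0 => by subst h0; exact (hy 0).choose.elim0) hp
  have hC : LabelSBP.IsClassSigned W y :=
    hW ▸ LabelSBP.isClassSigned_labelSBPGraph hA y ha hab
  refine ⟨hC.sid_eq_zero, ⟨_, _, hC.isBalancedPartition hy⟩, hC.isCompleteSigned,
    hC.isBalancedPartition hy, fun q hq α hα0 hα => ?_⟩
  obtain ⟨p, hp0, hp1, hpq⟩ := LabelSBP.exists_pos_le_of_selectsEdges hq hC.isCompleteSigned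
  obtain ⟨s, hs, hαs⟩ := LabelSBP.exists_exponent (r := 1 - 2 * α) (p := p / 2)
    (by linarith) (by linarith)
  have hβs : ∀ᶠ β : ℝ in atTop, (β / 2) ^ (-s) ≤ 1 / 4 :=
    ((tendsto_rpow_neg_atTop hs).comp (tendsto_id.atTop_div_const two_pos)).eventually_le_const
      (by norm_num)
  obtain ⟨β₁, hβ₁⟩ := eventually_atTop.1 hβs
  -- The bounds `2` and `1 / α` serve the path to polarization, `β₁` the drift. As `s` comes from
  -- `α` and `p` alone, neither `c` nor the initial state enters.
  refine ⟨max 2 (max (1 / α) β₁), lt_max_of_lt_left two_pos, fun β hβ c hc Ω _ P _ E hE => ?_⟩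
  have hβ2 : 2 ≤ β := (le_max_left _ _).trans hβ.le
  have hβα : 1 ≤ β * α := by
    rw [← div_le_iff₀ hα0]
    exact ((le_max_left _ _).trans (le_max_right _ _)).trans hβ.le
  have hβ1 : β₁ ≤ β := ((le_max_right _ _).trans (le_max_right _ _)).trans hβ.le
  obtain ⟨i, hi⟩ := hy 0
  obtain ⟨j, hj⟩ := hy 1
  have hij : i ≠ j := fun h => by simp [← h, hi] at hj
  have hne : Nonempty (Fin n) := ⟨i⟩
  have hQ : ∀ i j, i ≠ j → ∃ e, p ≤ (q e).toReal ∧ ∀ x,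
      LabelSBP.pairStep W α β c e x = LabelSBP.pairStep W α β c (i, j) x := by
    intro i j hij
    rcases hpq i j hij with h | h
    · exact ⟨(i, j), h, fun _ => rfl⟩
    · exact ⟨(j, i), h, LabelSBP.pairStep_swap hij⟩
  have hmeas : MeasurableSet {x : Fin n → ℝ | ∀ i, x i ∈ Set.Icc (-c) c} := by
    rw [Set.ofPred_forall]
    exact MeasurableSet.iInter fun i => measurable_pi_apply i measurableSet_Icc
  filter_upwards [ae_restrict_of_ae (LabelSBP.ae_spread_pos hij), ae_restrict_mem hmeas]
    with x₀ hx₀ hx₀c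
  refine hC.exists_limit hy hc (by linarith) hE.measurable
    (LabelSBP.measure_exists_mem_eq_one hE (Set.toFinite _).measurableSet ?_)
  refine hC.tendsto_avg_polar hy (fun _ => ENNReal.toReal_nonneg) (LabelSBP.sum_toReal_pmf q) ?_
    hc hα0 hα hβ2 hβα hp0 hp1 hQ hs hαs (hβ₁ β hβ1) hx₀c hx₀
  rintro ⟨i, j⟩ he
  exact (hq.edge_of_ne_zero i j fun h0 => he (by simp [h0])).1
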